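/- Let $J\in\{0,\tfrac12,1,\tfrac32,\dots\}$ and let $\mathcal{A}$ be a finite set of outcomes. The set $\mathcal{R}_J^{\mathcal{A}}$ of spin-$J$ correlations consists of all tuples $(P(a|\cdot))_{a\in\mathcal{A}}$ of functions $\mathbb{R}\to\mathbb{R}$ such that each $\theta\mapsto P(a|\theta)$ is a real trigonometric polynomial of degree at most $2J$, and $0\le P(a|\theta)\le 1$ and $\sum_{a}P(a|\theta)=1$ for all $\theta$. The set $\mathcal{Q}_J^{\mathcal{A}}$ of quantum spin-$J$ correlations consists of all tuples of the form $P(a|\theta)=\mathrm{Tr}(U_\theta\rho U_\theta^\dagger E_a)$, where $U_\theta=\bigoplus_{j=-J}^{J}\mathbf{1}_{n_j}e^{ij\theta}$ (the sum running over $j=-J,-J+1,\dots,J$) for some multiplicities $n_j\in\{0,1,2,\dots\}$, $\rho$ is a density matrix and $(E_a)_{a\in\mathcal{A}}$ is a POVM on the corresponding finite-dimensional Hilbert space $\bigoplus_j\mathbb{C}^{n_j}$. For $\mathcal{A}=\{-1,+1\}$ write $\mathcal{Q}_J$ and $\mathcal{R}_J$. Theorem. $\mathcal{Q}_1=\mathcal{R}_1$.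 Moreover, every real trigonometric polynomial $p$ of degree at most $2$ with $0\le p(\theta)\le 1$ for all $\theta$ is realized on a qutrit: there are a unit vector $\psi\in\mathbb{C}^3$ and a matrix $E$ with $0\le E\le\mathbf{1}$ such that $p(\theta)=\langle\psi|U_\theta^\dagger E\,U_\theta|\psi\rangle$ for all $\theta$, where $U_\theta=\mathrm{diag}(e^{i\theta},1,e^{-i\theta})$. -/

import Mathlib

open scoped Matrix ComplexOrder

noncomputable section

/-- `f` is a real trigonometric polynomial of degree at most `d`:
`f θ = c₀ + ∑_{j=1}^{d} (c_j cos (j θ) + s_j sin (j θ))`. -/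
def IsTrigPolyOfDegreeLE (d : ℕ) (f : ℝ → ℝ) : Prop :=
  ∃ c s : ℕ → ℝ, ∀ θ : ℝ,
    f θ = c 0 + ∑ j ∈ Finset.Icc 1 d, (c j * Real.cos (j * θ) + s j * Real.sin (j * θ))

/-- The set `R_J^A` of (general) spin-`J` correlations with outcome set `A`, where `J = twoJ / 2`:
tuples of probability functions that are trigonometric polynomials of degree at most `2J`. -/
def spinCorrelations (A : Type*) [Fintype A] (twoJ : ℕ) : Set (A → ℝ → ℝ) :=
  {P | (∀ a, IsTrigPolyOfDegreeLE twoJ (P a)) ∧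
    (∀ a θ, 0 ≤ P a θ ∧ P a θ ≤ 1) ∧
    ∀ θ, ∑ a, P a θ = 1}

/-- The index set of the orthonormal basis `|j, m⟩` of the representation space
`⨁_{j=-J}^{J} ℂ^{n_j}`. The weight `j = J - k` is labelled by `k = 0, …, 2J`, and `mult k` is its
multiplicity `n_j` (which may be zero). -/
abbrev SpinIndex (twoJ : ℕ) (mult : Fin (twoJ + 1) → ℕ) : Type :=
  Σ k : Fin (twoJ + 1), Fin (mult k)

/-- The projective unitary representation `U_θ = ⨁_{j=-J}^{J} 1_{n_j} e^{i j θ}` of `SO(2)`,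
where `J = twoJ / 2`. -/
def spinRotation (twoJ : ℕ) (mult : Fin (twoJ + 1) → ℕ) (θ : ℝ) :
    Matrix (SpinIndex twoJ mult) (SpinIndex twoJ mult) ℂ :=
  Matrix.diagonal fun x =>
    Complex.exp (Complex.I * ((twoJ : ℂ) / 2 - ((x.1 : ℕ) : ℂ)) * (θ : ℂ))

/-- A density matrix. -/
def IsDensityMatrix {ι : Type*} [Fintype ι] (ρ : Matrix ι ι ℂ) : Prop :=
  ρ.PosSemidef ∧ ρ.trace = 1

/-- A POVM with outcome set `A`. -/
def IsPOVM {ι A : Type*} [Fintype ι] [DecidableEq ι] [Fintype A] (E : A → Matrix ι ι ℂ) : Prop :=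
  (∀ a, (E a).PosSemidef) ∧ ∑ a, E a = 1

/-- The set `Q_J^A` of quantum spin-`J` correlations with outcome set `A`, where `J = twoJ / 2`:
tuples of functions of the form `P(a|θ) = Tr (U_θ ρ U_θ† E_a)`, for some multiplicities `n_j`,
density matrix `ρ` and POVM `E`. -/
def quantumSpinCorrelations (A : Type*) [Fintype A] (twoJ : ℕ) : Set (A → ℝ → ℝ) :=
  {P | ∃ (mult : Fin (twoJ + 1) → ℕ)
      (ρ : Matrix (SpinIndex twoJ mult) (SpinIndex twoJ mult) ℂ)
      (E : A → Matrix (SpinIndex twoJ mult) (SpinIndex twoJ mult) ℂ),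
      IsDensityMatrix ρ ∧ IsPOVM E ∧
      ∀ a θ, (P a θ : ℂ) =
        (spinRotation twoJ mult θ * ρ * (spinRotation twoJ mult θ)ᴴ * E a).trace}

/-- The qutrit rotation `exp (i θ Z)` with `Z = diag(1, 0, -1)`. -/
def qutritRotation (θ : ℝ) : Matrix (Fin 3) (Fin 3) ℂ :=
  Matrix.diagonal
    ![Complex.exp (Complex.I * (θ : ℂ)), 1, Complex.exp (-(Complex.I * (θ : ℂ)))]

end

/-! Let `v` be the phase vector of the qutrit. A nonnegative trigonometric polynomial of degree two
has the form `v* M v` with `M` positive semidefinite (Fejér–Riesz,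
`IsTrigPolyOfDegreeLE.exists_hasGramMatrix`). Apply this to `p` and to `1 - p`, giving `M` and `N`.
Gram matrices are not unique: averaging with the antitranspose makes both symmetric about the
antidiagonal (`HasGramMatrix.exists_symm`). Since `v* (M + N) v = 1`, the entries of `M + N` sum to
zero along each off-diagonal, and the symmetry turns this into `M + N = D` diagonal of trace one
(`HasGramMatrix.isDiag_of_one`). Then `ψ = √D` is a unit vector and `E = D^(-1/2) M D^(-1/2)` an
effect realizing `p` (`Matrix.PosSemidef.exists_effect`).

The inclusion of quantum correlations in spin correlations holds for every spin, by expanding the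
trace into frequencies. -/

open Matrix

/-! ### Gram matrices of the elementary nonnegative polynomials -/

/-- The vector `(e^{iθ}, 1, e^{-iθ})` of phases of a qutrit. -/
noncomputable def phaseVector (θ : ℝ) : Fin 3 → ℂ :=
  ![Complex.exp (Complex.I * (θ : ℂ)), 1, Complex.exp (-(Complex.I * (θ : ℂ)))]

/-- `f` is the quadratic form of a positive semidefinite matrix along the phase vectors. -/
def HasGramMatrix (f : ℝ → ℝ) (M : Matrix (Fin 3) (Fin 3) ℂ) : Prop :=
  M.PosSemidef ∧ ∀ θ, (f θ : ℂ) = star (phaseVector θ) ⬝ᵥ (M *ᵥ phaseVector θ)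

theorem star_exp_I_mul (θ : ℝ) :
    (starRingEnd ℂ) (Complex.exp (Complex.I * (θ : ℂ))) = Complex.exp (-(Complex.I * (θ : ℂ))) := by
  rw [← Complex.exp_conj]; simp

theorem star_exp_neg_I_mul (θ : ℝ) :
    (starRingEnd ℂ) (Complex.exp (-(Complex.I * (θ : ℂ)))) = Complex.exp (Complex.I * (θ : ℂ)) := by
  rw [← Complex.exp_conj]; simp

theorem exp_I_mul_mul_exp_neg (θ : ℝ) :
    Complex.exp (Complex.I * (θ : ℂ)) * Complex.exp (-(Complex.I * (θ : ℂ))) = 1 := by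
  rw [← Complex.exp_add]; simp

theorem HasGramMatrix.add {f g : ℝ → ℝ} {M N : Matrix (Fin 3) (Fin 3) ℂ}
    (hf : HasGramMatrix f M) (hg : HasGramMatrix g N) :
    HasGramMatrix (fun θ => f θ + g θ) (M + N) := by
  refine ⟨hf.1.add hg.1, fun θ => ?_⟩
  rw [Matrix.add_mulVec, dotProduct_add, ← hf.2, ← hg.2]
  push_cast; rfl

theorem HasGramMatrix.const_mul {f : ℝ → ℝ} {M : Matrix (Fin 3) (Fin 3) ℂ}
    (hf : HasGramMatrix f M) {c : ℝ} (hc : 0 ≤ c) :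
    HasGramMatrix (fun θ => c * f θ) ((c : ℂ) • M) := by
  refine ⟨hf.1.smul (by exact_mod_cast hc), fun θ => ?_⟩
  rw [Matrix.smul_mulVec, dotProduct_smul, ← hf.2]
  simp

theorem hasGramMatrix_normSq (w : Fin 3 → ℂ) :
    HasGramMatrix (fun θ => Complex.normSq (star w ⬝ᵥ phaseVector θ)) (vecMulVec w (star w)) := by
  refine ⟨posSemidef_vecMulVec_self_star w, fun θ => ?_⟩
  rw [Complex.normSq_eq_conj_mul_self, Matrix.vecMulVec_mulVec, dotProduct_smul]
  simp only [dotProduct, Fin.sum_univ_three, Pi.star_apply, map_add, map_mul, RCLike.star_def,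
    Complex.conj_conj, MulOpposite.smul_eq_mul_unop, MulOpposite.unop_op]
  ring

theorem normSq_one_sub_exp_mul_I (x : ℝ) :
    Complex.normSq (1 - Complex.exp ((x : ℂ) * Complex.I)) = 2 * (1 - Real.cos x) := by
  rw [Complex.normSq_apply, Complex.sub_re, Complex.sub_im, Complex.exp_ofReal_mul_I_re,
    Complex.exp_ofReal_mul_I_im, Complex.one_re, Complex.one_im]
  linear_combination Real.sin_sq_add_cos_sq x

theorem normSq_one_add_exp_mul_I (x : ℝ) :
    Complex.normSq (1 + Complex.exp ((x : ℂ) * Complex.I)) = 2 * (1 + Real.cos x) := by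
  rw [Complex.normSq_apply, Complex.add_re, Complex.add_im, Complex.exp_ofReal_mul_I_re,
    Complex.exp_ofReal_mul_I_im, Complex.one_re, Complex.one_im]
  linear_combination Real.sin_sq_add_cos_sq x

theorem exists_hasGramMatrix_const {m : ℝ} (hm : 0 ≤ m) :
    ∃ M, HasGramMatrix (fun _ => m) M := by
  have h := (hasGramMatrix_normSq ![0, 1, 0]).const_mul hm
  refine ⟨_, h.1, fun θ => ?_⟩
  rw [← h.2 θ]
  simp [dotProduct, Fin.sum_univ_three, phaseVector]

theorem exists_hasGramMatrix_one_sub_cos (t : ℝ) :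
    ∃ M, HasGramMatrix (fun θ => 1 - Real.cos (θ - t)) M := by
  have h := (hasGramMatrix_normSq ![-Complex.exp (Complex.I * (t : ℂ)), 1, 0]).const_mul
    (c := 1 / 2) (by norm_num)
  refine ⟨_, h.1, fun θ => ?_⟩
  rw [← h.2 θ]
  have e : star ![-Complex.exp (Complex.I * (t : ℂ)), 1, 0] ⬝ᵥ phaseVector θ
      = 1 - Complex.exp (((θ - t : ℝ) : ℂ) * Complex.I) := by
    simp only [dotProduct, Fin.sum_univ_three, phaseVector, Pi.star_apply, RCLike.star_def]
    simp [star_exp_I_mul, -Complex.ofReal_sub]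
    rw [← Complex.exp_add]
    push_cast
    ring_nf
  simp only [e, normSq_one_sub_exp_mul_I]
  push_cast
  ring

/-- Up to the factor `1 / 4`, this is the squared modulus of `e^{-iθ} (1 - e^{i(θ-t)}) (1 +
e^{i(θ-s)})`. The unimodular factor `e^{-iθ}` shifts the frequencies into `{-1, 0, 1}`. -/
theorem exists_hasGramMatrix_one_sub_cos_mul_one_add_cos (t s : ℝ) :
    ∃ M, HasGramMatrix (fun θ => (1 - Real.cos (θ - t)) * (1 + Real.cos (θ - s))) M := by
  have h := (hasGramMatrix_normSq ![-(Complex.exp (Complex.I * (t : ℂ)) *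
    Complex.exp (Complex.I * (s : ℂ))), Complex.exp (Complex.I * (s : ℂ)) -
    Complex.exp (Complex.I * (t : ℂ)), 1]).const_mul (c := 1 / 4) (by norm_num)
  refine ⟨_, h.1, fun θ => ?_⟩
  rw [← h.2 θ]
  have e : star ![-(Complex.exp (Complex.I * (t : ℂ)) * Complex.exp (Complex.I * (s : ℂ))),
      Complex.exp (Complex.I * (s : ℂ)) - Complex.exp (Complex.I * (t : ℂ)), 1] ⬝ᵥ phaseVector θ
      = Complex.exp (((-θ : ℝ) : ℂ) * Complex.I) *
        ((1 - Complex.exp (((θ - t : ℝ) : ℂ) * Complex.I)) *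
          (1 + Complex.exp (((θ - s : ℝ) : ℂ) * Complex.I))) := by
    have e1 : ∀ x : ℝ, Complex.exp (((θ - x : ℝ) : ℂ) * Complex.I) =
        Complex.exp (Complex.I * (θ : ℂ)) * Complex.exp (-(Complex.I * (x : ℂ))) := fun x => by
      rw [← Complex.exp_add]; push_cast; ring_nf
    have e2 : Complex.exp (((-θ : ℝ) : ℂ) * Complex.I) =
        Complex.exp (-(Complex.I * (θ : ℂ))) := by push_cast; ring_nf
    rw [e1, e1, e2]
    simp only [dotProduct, Fin.sum_univ_three, phaseVector, Pi.star_apply, RCLike.star_def]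
    simp only [cons_val_zero, cons_val_one, cons_val, map_neg, map_mul, map_sub, map_one,
      star_exp_I_mul]
    have h1 := exp_I_mul_mul_exp_neg θ
    generalize Complex.exp (Complex.I * (θ : ℂ)) = z at *
    generalize Complex.exp (-(Complex.I * (θ : ℂ))) = w at *
    generalize Complex.exp (-(Complex.I * (t : ℂ))) = A at *
    generalize Complex.exp (-(Complex.I * (s : ℂ))) = B at *
    linear_combination (A - B + A * B * z) * h1
  simp only [e, map_mul, normSq_one_sub_exp_mul_I, normSq_one_add_exp_mul_I]
  have e3 : Complex.normSq (Complex.exp (((-θ : ℝ) : ℂ) * Complex.I)) = 1 := by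
    rw [Complex.normSq_eq_norm_sq, Complex.norm_exp_ofReal_mul_I]; norm_num
  rw [e3]
  push_cast
  ring

/-! ### Fejér–Riesz in degree two -/

theorem exists_forall_le_of_periodic {f : ℝ → ℝ} (hf : Continuous f)
    (hp : Function.Periodic f (2 * Real.pi)) : ∃ x, ∀ y, f x ≤ f y := by
  obtain ⟨x, -, hx⟩ := isCompact_Icc.exists_isMinOn
    (Set.nonempty_Icc.2 Real.two_pi_pos.le) hf.continuousOn
  refine ⟨x, fun y => ?_⟩
  obtain ⟨z, hz, hy⟩ := hp.exists_mem_Ico₀ Real.two_pi_pos y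
  rw [hy]
  exact hx (Set.Ico_subset_Icc_self hz)

theorem exists_polar (b c : ℝ) :
    ∃ R α : ℝ, 0 ≤ R ∧ b = R * Real.cos α ∧ c = R * Real.sin α := by
  refine ⟨‖(⟨b, c⟩ : ℂ)‖, Complex.arg ⟨b, c⟩, norm_nonneg _, ?_, ?_⟩
  · rw [Complex.norm_mul_cos_arg]
  · rw [Complex.norm_mul_sin_arg]

/-- The value, derivative and sign of a trigonometric polynomial of degree two at a zero of it
where it is minimal force a factor `1 - cos`. -/
theorem exists_eq_one_sub_cos_mul {A₀ A₁ B₁ A₂ B₂ : ℝ}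
    (h0 : A₀ + A₁ + A₂ = 0)
    (hpos : ∀ x, 0 ≤ A₀ + A₁ * Real.cos x + B₁ * Real.sin x + A₂ * Real.cos (2 * x) +
      B₂ * Real.sin (2 * x)) :
    ∃ a R α : ℝ, 0 ≤ a ∧ 0 ≤ R ∧ ∀ x,
      A₀ + A₁ * Real.cos x + B₁ * Real.sin x + A₂ * Real.cos (2 * x) + B₂ * Real.sin (2 * x) =
        (1 - Real.cos x) * (a + R * (1 + Real.cos (x - α))) := by
  have hder : B₁ + 2 * B₂ = 0 := by
    have hd : HasDerivAt (fun x : ℝ => A₀ + A₁ * Real.cos x + B₁ * Real.sin x +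
        A₂ * Real.cos (2 * x) + B₂ * Real.sin (2 * x)) (B₁ + 2 * B₂) 0 := by
      have h2 : HasDerivAt (fun x : ℝ => 2 * x) 2 0 := by
        simpa using (hasDerivAt_id (0 : ℝ)).const_mul 2
      have := (((((Real.hasDerivAt_cos 0).const_mul A₁).const_add A₀).add
        ((Real.hasDerivAt_sin 0).const_mul B₁)).add ((h2.cos).const_mul A₂)).add
        ((h2.sin).const_mul B₂)
      refine this.congr_deriv ?_
      simp
      ring
    refine IsLocalMin.hasDerivAt_eq_zero (Filter.Eventually.of_forall fun x => ?_) hd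
    simpa [h0] using hpos x
  have hfac : ∀ x, A₀ + A₁ * Real.cos x + B₁ * Real.sin x + A₂ * Real.cos (2 * x) +
      B₂ * Real.sin (2 * x) = (1 - Real.cos x) *
        (-A₁ - 2 * A₂ + (-2 * A₂) * Real.cos x + (-2 * B₂) * Real.sin x) := fun x => by
    rw [Real.cos_two_mul, Real.sin_two_mul]
    linear_combination h0 + Real.sin x * hder
  obtain ⟨R, α, hR, hb, hc⟩ := exists_polar (-2 * A₂) (-2 * B₂)
  have hr : ∀ x, -A₁ - 2 * A₂ + (-2 * A₂) * Real.cos x + (-2 * B₂) * Real.sin x =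
      (-A₁ - 2 * A₂ - R) + R * (1 + Real.cos (x - α)) := fun x => by
    rw [Real.cos_sub, hb, hc]; ring
  refine ⟨-A₁ - 2 * A₂ - R, R, α, ?_, hR, fun x => by rw [hfac, hr]⟩
  have hcont : Continuous fun x : ℝ => (-A₁ - 2 * A₂ - R) + R * (1 + Real.cos (x - α)) := by
    fun_prop
  have hnonneg : ∀ x, Real.cos x ≠ 1 →
      0 ≤ (-A₁ - 2 * A₂ - R) + R * (1 + Real.cos (x - α)) := fun x hx => by
    have h1 : 0 < 1 - Real.cos x := sub_pos.2 (lt_of_le_of_ne (Real.cos_le_one x) hx)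
    have h2 := hpos x
    rw [hfac, hr] at h2
    exact nonneg_of_mul_nonneg_right h2 h1
  -- The cofactor must be tested at its minimum `α + π`, where `1 - cos` may vanish; density and
  -- continuity cover that case.
  have hdense : Dense {x : ℝ | Real.cos x ≠ 1} := by
    have hs : {x : ℝ | Real.cos x ≠ 1}ᶜ = Set.range fun n : ℤ => (n : ℝ) * (2 * Real.pi) := by
      ext x
      simp [Real.cos_eq_one_iff]
    have := (Set.countable_range fun n : ℤ => (n : ℝ) * (2 * Real.pi)).dense_compl ℝ
    rwa [← hs, compl_compl] at this
  have hall : ∀ x, 0 ≤ (-A₁ - 2 * A₂ - R) + R * (1 + Real.cos (x - α)) := fun x =>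
    closure_minimal (s := {x : ℝ | Real.cos x ≠ 1}) (fun y hy => hnonneg y hy)
      (isClosed_le continuous_const hcont) (hdense x)
  have := hall (α + Real.pi)
  simpa using this

/-- Fejér–Riesz in degree two, in the form of a Gram matrix. -/
theorem IsTrigPolyOfDegreeLE.exists_hasGramMatrix {p : ℝ → ℝ} (hp : IsTrigPolyOfDegreeLE 2 p)
    (hpos : ∀ θ, 0 ≤ p θ) : ∃ M, HasGramMatrix p M := by
  obtain ⟨c, s, hcs⟩ := hp
  have hp2 : ∀ θ, p θ = c 0 + (c 1 * Real.cos θ + s 1 * Real.sin θ +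
      (c 2 * Real.cos (2 * θ) + s 2 * Real.sin (2 * θ))) := fun θ => by
    rw [hcs, Finset.sum_Icc_succ_top (by norm_num)]
    simp
  have hcont : Continuous p := by
    rw [funext hp2]; fun_prop
  have hper : Function.Periodic p (2 * Real.pi) := fun θ => by
    have h4 : 2 * (θ + 2 * Real.pi) = 2 * θ + 2 * Real.pi + 2 * Real.pi := by ring
    rw [hp2, hp2, h4]
    simp only [Real.cos_add_two_pi, Real.sin_add_two_pi]
  obtain ⟨t, ht⟩ := exists_forall_le_of_periodic hcont hper
  have key : ∀ x, p (x + t) - p t = (c 0 - p t) + (c 1 * Real.cos t + s 1 * Real.sin t) * Real.cos x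
      + (s 1 * Real.cos t - c 1 * Real.sin t) * Real.sin x
      + (c 2 * Real.cos (2 * t) + s 2 * Real.sin (2 * t)) * Real.cos (2 * x)
      + (s 2 * Real.cos (2 * t) - c 2 * Real.sin (2 * t)) * Real.sin (2 * x) := fun x => by
    rw [hp2 (x + t), mul_add, Real.cos_add, Real.sin_add, Real.cos_add, Real.sin_add]
    ring
  obtain ⟨a, R, α, ha, hR, h⟩ := exists_eq_one_sub_cos_mul
    (A₀ := c 0 - p t) (A₁ := c 1 * Real.cos t + s 1 * Real.sin t)
    (A₂ := c 2 * Real.cos (2 * t) + s 2 * Real.sin (2 * t))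
    (by simpa using (key 0).symm) (fun x => by rw [← key]; linarith [ht (x + t)])
  obtain ⟨M₀, h₀⟩ := exists_hasGramMatrix_const (hpos t)
  obtain ⟨M₁, h₁⟩ := exists_hasGramMatrix_one_sub_cos t
  obtain ⟨M₂, h₂⟩ := exists_hasGramMatrix_one_sub_cos_mul_one_add_cos t (t + α)
  -- `p` is its minimum `p t`, plus `a (1 - cos (θ - t))`, plus `R (1 - cos (θ - t)) (1 + cos (θ - t
  -- - α))`.
  have := (h₀.add (h₁.const_mul ha)).add (h₂.const_mul hR)
  refine ⟨_, this.1, fun θ => ?_⟩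
  rw [← this.2]
  have e := key (θ - t)
  rw [h, sub_add_cancel, sub_sub] at e
  congr 1
  linarith

/-! ### Symmetrization about the antidiagonal -/

theorem phaseVector_rev (θ : ℝ) (i : Fin 3) :
    phaseVector θ i.rev = (starRingEnd ℂ) (phaseVector θ i) := by
  fin_cases i <;> simp [phaseVector, star_exp_I_mul, star_exp_neg_I_mul, Fin.rev]

/-- The reflection of a matrix in its antidiagonal. -/
def Matrix.antitranspose {n : ℕ} (M : Matrix (Fin n) (Fin n) ℂ) : Matrix (Fin n) (Fin n) ℂ :=
  Mᵀ.submatrix Fin.rev Fin.rev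

/-- Reversing the phase vector conjugates it, and a scalar equals its transpose. -/
theorem HasGramMatrix.antitranspose {f : ℝ → ℝ} {M : Matrix (Fin 3) (Fin 3) ℂ}
    (hf : HasGramMatrix f M) : HasGramMatrix f M.antitranspose := by
  refine ⟨hf.1.transpose.submatrix _, fun θ => ?_⟩
  rw [hf.2]
  have h0 := phaseVector_rev θ 0
  have h1 := phaseVector_rev θ 1
  have h2 := phaseVector_rev θ 2
  simp only [show Fin.rev (0 : Fin 3) = 2 from rfl, show Fin.rev (1 : Fin 3) = 1 from rfl,
    show Fin.rev (2 : Fin 3) = 0 from rfl] at h0 h1 h2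
  simp only [dotProduct, mulVec, Fin.sum_univ_three, Pi.star_apply, RCLike.star_def, ← h0, ← h1,
    ← h2, Matrix.antitranspose, submatrix_apply, transpose_apply,
    show Fin.rev (0 : Fin 3) = 2 from rfl, show Fin.rev (1 : Fin 3) = 1 from rfl,
    show Fin.rev (2 : Fin 3) = 0 from rfl]
  ring

/-- A function with a Gram matrix has one that is symmetric about the antidiagonal. -/
theorem HasGramMatrix.exists_symm {f : ℝ → ℝ} {M : Matrix (Fin 3) (Fin 3) ℂ}
    (hf : HasGramMatrix f M) : ∃ N, HasGramMatrix f N ∧ N 0 1 = N 1 2 := by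
  have h := (hf.add hf.antitranspose).const_mul (c := 1 / 2) (by norm_num)
  refine ⟨_, ⟨h.1, fun θ => ?_⟩, ?_⟩
  · rw [← h.2]; push_cast; ring
  · simp [Matrix.antitranspose, show Fin.rev (0 : Fin 3) = 2 from rfl,
      show Fin.rev (1 : Fin 3) = 1 from rfl, show Fin.rev (2 : Fin 3) = 0 from rfl, add_comm]

theorem phaseVector_eq (θ : ℝ) : phaseVector θ = ![Real.cos θ + Real.sin θ * Complex.I, 1,
    Real.cos θ - Real.sin θ * Complex.I] := by
  ext i
  fin_cases i
  · simp [phaseVector, mul_comm Complex.I, Complex.exp_mul_I]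
  · rfl
  · simp [phaseVector, mul_comm Complex.I, ← neg_mul, Complex.exp_mul_I, sub_eq_add_neg]

/-- A Gram matrix of the constant one that is symmetric about the antidiagonal is diagonal. -/
theorem HasGramMatrix.isDiag_of_one {M : Matrix (Fin 3) (Fin 3) ℂ}
    (hM : HasGramMatrix (fun _ => 1) M) (hs : M 0 1 = M 1 2) :
    M = diagonal M.diag ∧ M.trace = 1 := by
  have h10 : M 1 0 = (starRingEnd ℂ) (M 0 1) := (hM.1.isHermitian.apply 1 0).symm
  have h21 : M 2 1 = (starRingEnd ℂ) (M 0 1) := by rw [hs]; exact (hM.1.isHermitian.apply 2 1).symm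
  have key : ∀ θ : ℝ, (1 : ℂ) = M.trace + (Real.cos θ + Real.sin θ * Complex.I) * (2 * M 1 0)
      + (Real.cos θ - Real.sin θ * Complex.I) * (2 * M 0 1)
      + (Real.cos θ + Real.sin θ * Complex.I) ^ 2 * M 2 0
      + (Real.cos θ - Real.sin θ * Complex.I) ^ 2 * M 0 2 := fun θ => by
    have e := hM.2 θ
    have hcs : (Real.cos θ : ℂ) ^ 2 + (Real.sin θ : ℂ) ^ 2 = 1 := by
      exact_mod_cast Real.cos_sq_add_sin_sq θ
    rw [phaseVector_eq, Complex.ofReal_one] at e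
    simp only [dotProduct, mulVec, Fin.sum_univ_three, Pi.star_apply, RCLike.star_def,
      cons_val_zero, cons_val_one, cons_val, map_add, map_sub, map_mul, Complex.conj_ofReal,
      Complex.conj_I, map_one, ← hs, h21, ← h10] at e
    rw [trace_fin_three]
    linear_combination e + (M 0 0 + M 2 2) * hcs - Real.sin θ ^ 2 * (M 0 0 + M 2 2) * Complex.I_sq
  -- Five samples determine the five Fourier coefficients: the multiples of `π / 2` leave only `M 2
  -- 0 - M 0 2` open, which `π / 4` settles.
  have k0 := key 0
  have k1 := key Real.pi
  have k2 := key (Real.pi / 2)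
  have k3 := key (-(Real.pi / 2))
  have k4 := key (Real.pi / 4)
  simp only [Real.cos_zero, Real.sin_zero, Real.cos_pi, Real.sin_pi, Real.cos_neg, Real.sin_neg,
    Real.cos_pi_div_two, Real.sin_pi_div_two] at k0 k1 k2 k3
  rw [Real.cos_pi_div_four, Real.sin_pi_div_four] at k4
  have h2 : ((√2 : ℝ) : ℂ) ^ 2 = 2 := by exact_mod_cast Real.sq_sqrt (by norm_num : (0 : ℝ) ≤ 2)
  push_cast at k0 k1 k2 k3 k4
  have hI := Complex.I_sq
  have htr : M.trace = 1 := by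
    linear_combination (-1 / 4) * (k0 + k1 + k2 + k3) - (1 / 2) * (M 2 0 + M 0 2) * hI
  have hu : M 1 0 + M 0 1 = 0 := by linear_combination (k1 - k0) / 4
  have hu' : M 1 0 - M 0 1 = 0 := by
    linear_combination Complex.I * (k2 - k3) / 4 + (M 1 0 - M 0 1) * hI
  have hw : M 2 0 + M 0 2 = 0 := by linear_combination -(k0 + k1) / 2 - htr
  have z01 : M 0 1 = 0 := by linear_combination (hu - hu') / 2
  have z10 : M 1 0 = 0 := by linear_combination (hu + hu') / 2
  rw [z01, z10, htr] at k4
  have hw' : M 2 0 - M 0 2 = 0 := by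
    linear_combination Complex.I * k4 + (M 2 0 - M 0 2) * hI +
      (Complex.I / 4 * (1 + Complex.I ^ 2) * (M 2 0 + M 0 2) +
        Complex.I ^ 2 / 2 * (M 2 0 - M 0 2)) * h2 + (Complex.I / 2) * (M 2 0 + M 0 2) * hI
  have z02 : M 0 2 = 0 := by linear_combination (hw - hw') / 2
  have z20 : M 2 0 = 0 := by linear_combination (hw + hw') / 2
  refine ⟨?_, htr⟩
  have z12 : M 1 2 = 0 := hs ▸ z01
  have z21 : M 2 1 = 0 := by rw [h21, z01, map_zero]
  ext i j
  fin_cases i <;> fin_cases j <;> simp [*]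

/-! ### State and effect from a pair of Gram matrices -/

theorem Matrix.PosSemidef.apply_eq_zero_of_diag {ι : Type*} [Fintype ι] [DecidableEq ι]
    {M : Matrix ι ι ℂ} (hM : M.PosSemidef) {i : ι} (hi : M i i = 0) (j : ι) :
    M i j = 0 ∧ M j i = 0 := by
  have h : M *ᵥ Pi.single i 1 = 0 := by
    rw [← hM.dotProduct_mulVec_zero_iff]
    simp [hi]
  have hji : M j i = 0 := by simpa using congrFun h j
  exact ⟨by rw [← hM.isHermitian.apply, hji, star_zero], hji⟩

/-- Positive semidefinite matrices with diagonal sum of unit trace come from a two-outcome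
measurement on a pure state. -/
theorem Matrix.PosSemidef.exists_effect {ι : Type*} [Fintype ι] [DecidableEq ι]
    {M N : Matrix ι ι ℂ} (hM : M.PosSemidef) (hN : N.PosSemidef) {d : ι → ℂ}
    (hd : M + N = diagonal d) (htr : ∑ i, d i = 1) :
    ∃ (ψ : ι → ℂ) (E : Matrix ι ι ℂ), star ψ ⬝ᵥ ψ = 1 ∧ E.PosSemidef ∧ (1 - E).PosSemidef ∧
      ∀ v : ι → ℂ, star v ⬝ᵥ (M *ᵥ v) = star (v * ψ) ⬝ᵥ (E *ᵥ (v * ψ)) := by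
  have hdi : ∀ i, M i i + N i i = d i := fun i => by
    simpa using congrFun (congrFun hd i) i
  have hd0 : ∀ i, 0 ≤ d i := fun i => hdi i ▸ add_nonneg hM.diag_nonneg hN.diag_nonneg
  choose r hr0 hr using fun i => RCLike.nonneg_iff_exists_ofReal.1 (hd0 i)
  replace hr : ∀ i, ((r i : ℝ) : ℂ) = d i := hr
  -- As `0⁻¹ = 0`, `diagonal g` is the pseudo-inverse of `√D`. Where `d i = 0`, row and column `i`
  -- of `M` vanish, so nothing is lost.
  set g : ι → ℂ := fun i => (((√(r i))⁻¹ : ℝ) : ℂ) with hg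
  have hgs : (diagonal g)ᴴ = diagonal g := by
    rw [diagonal_conjTranspose]; congr 1; ext i; simp [hg]
  have hsq : ∀ i, ((√(r i) : ℝ) : ℂ) * ((√(r i) : ℝ) : ℂ) = d i := fun i => by
    rw [← hr i]; exact_mod_cast Real.mul_self_sqrt (hr0 i)
  have hzero : ∀ i, √(r i) = 0 → M i i = 0 := fun i hi => by
    have h := hdi i
    rw [← hsq i, hi] at h
    simp only [Complex.ofReal_zero, mul_zero] at h
    exact ((add_eq_zero_iff_of_nonneg hM.diag_nonneg hN.diag_nonneg).1 h).1
  refine ⟨fun i => ((√(r i) : ℝ) : ℂ), diagonal g * M * diagonal g, ?_, ?_, ?_, fun v => ?_⟩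
  · rw [← htr]
    exact Finset.sum_congr rfl fun i _ => by simp [hsq]
  · simpa [hgs] using hM.mul_mul_conjTranspose_same (diagonal g)
  -- The last summand is the projection onto the coordinates with `d i = 0`.
  · have e : 1 - diagonal g * M * diagonal g =
        diagonal g * N * diagonal g + diagonal fun i => 1 - g i * d i * g i := by
      have hM' : M = diagonal d - N := by rw [← hd, add_sub_cancel_right]
      rw [hM', mul_sub, sub_mul, diagonal_mul_diagonal, diagonal_mul_diagonal,
        ← diagonal_one, ← diagonal_sub]
      abel
    rw [e]
    refine PosSemidef.add (by simpa [hgs] using hN.mul_mul_conjTranspose_same (diagonal g))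
      (PosSemidef.diagonal fun i => ?_)
    rw [← hsq i]
    by_cases h : √(r i) = 0
    · simp [hg, h]
    · have h' : ((√(r i) : ℝ) : ℂ) ≠ 0 := by exact_mod_cast h
      simp [hg]
      field_simp
      simp
  · simp only [dotProduct, mulVec, Finset.mul_sum]
    refine Finset.sum_congr rfl fun i _ => Finset.sum_congr rfl fun j _ => ?_
    rw [mul_diagonal, diagonal_mul]
    simp only [Pi.star_apply, Pi.mul_apply, RCLike.star_def, map_mul, Complex.conj_ofReal, hg]
    by_cases hi : √(r i) = 0
    · simp [(hM.apply_eq_zero_of_diag (hzero i hi) j).1]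
    by_cases hj : √(r j) = 0
    · simp [(hM.apply_eq_zero_of_diag (hzero j hj) i).2]
    have hi' : ((√(r i) : ℝ) : ℂ) ≠ 0 := by exact_mod_cast hi
    have hj' : ((√(r j) : ℝ) : ℂ) ≠ 0 := by exact_mod_cast hj
    push_cast
    field_simp

theorem IsTrigPolyOfDegreeLE.const_sub {d : ℕ} {p : ℝ → ℝ} (hp : IsTrigPolyOfDegreeLE d p)
    (a : ℝ) : IsTrigPolyOfDegreeLE d fun θ => a - p θ := by
  obtain ⟨c, s, h⟩ := hp
  refine ⟨fun j => (if j = 0 then a else 0) - c j, fun j => -s j, fun θ => ?_⟩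
  simp only [h, if_true]
  rw [sub_add_eq_sub_sub, sub_eq_add_neg (a - c 0), ← Finset.sum_neg_distrib]
  congr 1
  refine Finset.sum_congr rfl fun j hj => ?_
  rw [if_neg (by have := (Finset.mem_Icc.1 hj).1; omega)]
  ring

theorem qutritRotation_mulVec (θ : ℝ) (ψ : Fin 3 → ℂ) :
    qutritRotation θ *ᵥ ψ = phaseVector θ * ψ := by
  ext i
  rw [qutritRotation, mulVec_diagonal]
  rfl

/-- Trigonometric polynomials of degree at most two with values in `[0, 1]` are realized on a
qutrit. -/
theorem IsTrigPolyOfDegreeLE.exists_qutrit {p : ℝ → ℝ} (hp : IsTrigPolyOfDegreeLE 2 p)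
    (h01 : ∀ θ, 0 ≤ p θ ∧ p θ ≤ 1) :
    ∃ (ψ : Fin 3 → ℂ) (E : Matrix (Fin 3) (Fin 3) ℂ),
      star ψ ⬝ᵥ ψ = 1 ∧ E.PosSemidef ∧ (1 - E).PosSemidef ∧
      ∀ θ : ℝ, (p θ : ℂ) =
        star (qutritRotation θ *ᵥ ψ) ⬝ᵥ (E *ᵥ (qutritRotation θ *ᵥ ψ)) := by
  obtain ⟨M₀, hM₀⟩ := hp.exists_hasGramMatrix fun θ => (h01 θ).1
  obtain ⟨N₀, hN₀⟩ := (hp.const_sub 1).exists_hasGramMatrix fun θ => sub_nonneg.2 (h01 θ).2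
  obtain ⟨M, hM, hMs⟩ := hM₀.exists_symm
  obtain ⟨N, hN, hNs⟩ := hN₀.exists_symm
  have hsum := hM.add hN
  simp only [add_sub_cancel] at hsum
  obtain ⟨hdiag, htr⟩ := hsum.isDiag_of_one (by simp [hMs, hNs])
  obtain ⟨ψ, E, hψ, hE, hE', h⟩ := hM.1.exists_effect hN.1 hdiag htr
  refine ⟨ψ, E, hψ, hE, hE', fun θ => ?_⟩
  rw [qutritRotation_mulVec, ← h, hM.2]

/-! ### Quantum correlations are trigonometric polynomials -/

theorem isTrigPolyOfDegreeLE_cos_sin {d n : ℕ} (hn : n ≤ d) (A B : ℝ) :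
    IsTrigPolyOfDegreeLE d fun θ => A * Real.cos (n * θ) + B * Real.sin (n * θ) := by
  refine ⟨fun j => if j = n then A else 0, fun j => if j = n then B else 0, fun θ => ?_⟩
  have hterm : ∀ j : ℕ, (if j = n then A else 0) * Real.cos (j * θ) +
      (if j = n then B else 0) * Real.sin (j * θ) =
      if j = n then A * Real.cos (n * θ) + B * Real.sin (n * θ) else 0 := fun j => by
    split_ifs with h <;> simp [h]
  simp only [hterm, Finset.sum_ite_eq', Finset.mem_Icc]
  rcases Nat.eq_zero_or_pos n with rfl | h
  · simp
  · rw [if_neg h.ne, if_pos ⟨h, hn⟩, zero_add]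

theorem IsTrigPolyOfDegreeLE.add {d : ℕ} {f g : ℝ → ℝ} (hf : IsTrigPolyOfDegreeLE d f)
    (hg : IsTrigPolyOfDegreeLE d g) : IsTrigPolyOfDegreeLE d fun θ => f θ + g θ := by
  obtain ⟨c, s, h⟩ := hf
  obtain ⟨c', s', h'⟩ := hg
  refine ⟨fun j => c j + c' j, fun j => s j + s' j, fun θ => ?_⟩
  simp only [h, h']
  rw [add_add_add_comm, ← Finset.sum_add_distrib]
  congr 1
  exact Finset.sum_congr rfl fun j _ => by ring

theorem IsTrigPolyOfDegreeLE.sum {ι : Type*} {d : ℕ} (t : Finset ι) {f : ι → ℝ → ℝ}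
    (hf : ∀ i ∈ t, IsTrigPolyOfDegreeLE d (f i)) :
    IsTrigPolyOfDegreeLE d fun θ => ∑ i ∈ t, f i θ := by
  classical
  induction t using Finset.induction_on with
  | empty => exact ⟨fun _ => 0, fun _ => 0, fun θ => by simp⟩
  | insert a t ha ih =>
    simp only [Finset.sum_insert ha]
    exact (hf a (Finset.mem_insert_self a t)).add
      (ih fun i hi => hf i (Finset.mem_insert_of_mem hi))

theorem isTrigPolyOfDegreeLE_re_mul_exp {d : ℕ} {k : ℤ} (hk : k.natAbs ≤ d) (z : ℂ) :
    IsTrigPolyOfDegreeLE d fun θ => (z * Complex.exp (((k * θ : ℝ) : ℂ) * Complex.I)).re := by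
  have e : ∀ θ : ℝ, (z * Complex.exp (((k * θ : ℝ) : ℂ) * Complex.I)).re =
      z.re * Real.cos (k * θ) + -z.im * Real.sin (k * θ) := fun θ => by
    rw [Complex.mul_re, Complex.exp_ofReal_mul_I_re, Complex.exp_ofReal_mul_I_im]; ring
  simp only [e]
  obtain ⟨n, rfl | rfl⟩ := k.eq_nat_or_neg
  · simpa using isTrigPolyOfDegreeLE_cos_sin (by simpa using hk) z.re (-z.im)
  · simpa using isTrigPolyOfDegreeLE_cos_sin (by simpa using hk) z.re z.im

theorem spinRotation_conjTranspose_mul_self (twoJ : ℕ) (mult : Fin (twoJ + 1) → ℕ) (θ : ℝ) :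
    (spinRotation twoJ mult θ)ᴴ * spinRotation twoJ mult θ = 1 := by
  rw [spinRotation, diagonal_conjTranspose, diagonal_mul_diagonal, ← diagonal_one]
  congr 1
  ext x
  simp only [Pi.star_apply, RCLike.star_def, ← Complex.exp_conj, ← Complex.exp_add]
  simp [Complex.conj_ofNat]

/-- The offset `J` cancels between `U` and `Uᴴ`, so only integer frequencies, at most `2J` in
modulus, survive even for half-integer spin. -/
theorem trace_spinRotation (twoJ : ℕ) (mult : Fin (twoJ + 1) → ℕ)
    (ρ E : Matrix (SpinIndex twoJ mult) (SpinIndex twoJ mult) ℂ) (θ : ℝ) :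
    (spinRotation twoJ mult θ * ρ * (spinRotation twoJ mult θ)ᴴ * E).trace =
      ∑ x, ∑ y, ρ x y * E y x *
        Complex.exp ((((((y.1 : ℕ) : ℤ) - ((x.1 : ℕ) : ℤ) : ℤ) * θ : ℝ) : ℂ) * Complex.I) := by
  refine Finset.sum_congr rfl fun x _ => ?_
  rw [diag_apply, Matrix.mul_apply]
  refine Finset.sum_congr rfl fun y _ => ?_
  rw [spinRotation, diagonal_conjTranspose, mul_diagonal, diagonal_mul]
  simp only [Pi.star_apply, RCLike.star_def, ← Complex.exp_conj]
  rw [mul_right_comm _ (ρ x y), ← Complex.exp_add, mul_assoc, mul_comm]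
  congr 2
  simp [Complex.conj_ofNat]
  ring

theorem Matrix.PosSemidef.trace_mul_nonneg {ι : Type*} [Fintype ι] {A B : Matrix ι ι ℂ}
    (hA : A.PosSemidef) (hB : B.PosSemidef) : 0 ≤ (A * B).trace := by
  classical
  open scoped MatrixOrder in
  obtain ⟨C, rfl⟩ := CStarAlgebra.nonneg_iff_eq_star_mul_self.mp hB.nonneg
  rw [← mul_assoc, trace_mul_comm, ← mul_assoc]
  exact (hA.mul_mul_conjTranspose_same C).trace_nonneg

/-- Quantum spin correlations are spin correlations, for every spin and every outcome set. -/
theorem quantumSpinCorrelations_subset (A : Type*) [Fintype A] (twoJ : ℕ) :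
    quantumSpinCorrelations A twoJ ⊆ spinCorrelations A twoJ := by
  rintro P ⟨mult, ρ, E, ⟨hρ, hρ1⟩, ⟨hE, hE1⟩, h⟩
  have hsum : ∀ θ, ∑ a, P a θ = 1 := fun θ => by
    have : ((∑ a, P a θ : ℝ) : ℂ) = 1 := by
      push_cast
      simp only [h]
      rw [← trace_sum, ← Finset.mul_sum, hE1, mul_one, trace_mul_comm, ← mul_assoc,
        spinRotation_conjTranspose_mul_self, one_mul, hρ1]
    exact_mod_cast this
  have hpos : ∀ a θ, 0 ≤ P a θ := fun a θ => by
    have := (hρ.mul_mul_conjTranspose_same (spinRotation twoJ mult θ)).trace_mul_nonneg (hE a)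
    rw [← h] at this
    exact_mod_cast this
  refine ⟨fun a => ?_, fun a θ => ⟨hpos a θ, ?_⟩, hsum⟩
  · have e : P a = fun θ => ∑ x, ∑ y, (ρ x y * E a y x *
        Complex.exp ((((((y.1 : ℕ) : ℤ) - ((x.1 : ℕ) : ℤ) : ℤ) * θ : ℝ) : ℂ) * Complex.I)).re := by
      ext θ
      rw [← Complex.ofReal_re (P a θ), h, trace_spinRotation]
      simp only [Complex.re_sum]
    rw [e]
    refine IsTrigPolyOfDegreeLE.sum _ fun x _ => IsTrigPolyOfDegreeLE.sum _ fun y _ =>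
      isTrigPolyOfDegreeLE_re_mul_exp ?_ _
    have := x.1.isLt
    have := y.1.isLt
    omega
  · rw [← hsum θ]
    exact Finset.single_le_sum (fun b _ => hpos b θ) (Finset.mem_univ a)

/-! ### Transport of the qutrit model to spin one -/

theorem Matrix.trace_mul_vecMulVec_mul {ι : Type*} [Fintype ι] (U E : Matrix ι ι ℂ) (ψ : ι → ℂ) :
    (U * vecMulVec ψ (star ψ) * Uᴴ * E).trace = star (U *ᵥ ψ) ⬝ᵥ (E *ᵥ (U *ᵥ ψ)) := by
  rw [mul_vecMulVec, vecMulVec_mul, vecMulVec_mul, trace_vecMulVec, ← star_mulVec,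
    dotProduct_comm, ← dotProduct_mulVec]

/-- The basis of the spin-one representation without multiplicities. -/
def spinOneIndexEquiv : SpinIndex 2 (fun _ => 1) ≃ Fin 3 :=
  Equiv.sigmaUnique (Fin 3) fun _ => Fin 1

theorem spinRotation_two (θ : ℝ) :
    spinRotation 2 (fun _ => 1) θ =
      (qutritRotation θ).submatrix spinOneIndexEquiv spinOneIndexEquiv := by
  rw [qutritRotation, submatrix_diagonal_equiv, spinRotation]
  congr 1
  ext ⟨k, i⟩
  change _ = ![Complex.exp (Complex.I * (θ : ℂ)), 1, Complex.exp (-(Complex.I * (θ : ℂ)))] k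
  fin_cases k
  · simp
  · simp
  · simp
    ring_nf

theorem Int.sum_units {M : Type*} [AddCommMonoid M] (f : ℤˣ → M) : ∑ a, f a = f 1 + f (-1) := by
  rw [show (Finset.univ : Finset ℤˣ) = {1, -1} from rfl, Finset.sum_pair (by decide)]

theorem mainTheorem2 :
    quantumSpinCorrelations ℤˣ 2 = spinCorrelations ℤˣ 2 ∧
    ∀ p : ℝ → ℝ, IsTrigPolyOfDegreeLE 2 p → (∀ θ, 0 ≤ p θ ∧ p θ ≤ 1) →
      ∃ (ψ : Fin 3 → ℂ) (E : Matrix (Fin 3) (Fin 3) ℂ),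
        star ψ ⬝ᵥ ψ = 1 ∧ E.PosSemidef ∧ (1 - E).PosSemidef ∧
        ∀ θ : ℝ, (p θ : ℂ) =
          star (qutritRotation θ *ᵥ ψ) ⬝ᵥ (E *ᵥ (qutritRotation θ *ᵥ ψ)) := by
  refine ⟨(quantumSpinCorrelations_subset _ _).antisymm ?_, fun p hp h01 => hp.exists_qutrit h01⟩
  rintro P ⟨htrig, h01, hsum⟩
  obtain ⟨ψ, E, hψ, hE, hE', h⟩ := (htrig 1).exists_qutrit (h01 1)
  have hρ : (vecMulVec ψ (star ψ)).trace = 1 := by rw [trace_vecMulVec, dotProduct_comm, hψ]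
  have htrace : ∀ M : Matrix (Fin 3) (Fin 3) ℂ,
      (M.submatrix spinOneIndexEquiv spinOneIndexEquiv).trace = M.trace := fun M =>
    spinOneIndexEquiv.sum_comp fun i => M i i
  -- Only outcome `1` needs a realization; normalization then determines outcome `-1`.
  let F : ℤˣ → Matrix (Fin 3) (Fin 3) ℂ := fun a => if a = 1 then E else 1 - E
  have hF1 : F 1 = E := if_pos rfl
  have hF2 : F (-1) = 1 - E := if_neg (by decide)
  have hq : ∀ θ, (qutritRotation θ)ᴴ * qutritRotation θ = 1 := fun θ => by
    have := spinRotation_conjTranspose_mul_self 2 (fun _ => 1) θ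
    rw [spinRotation_two, conjTranspose_submatrix, submatrix_mul_equiv,
      ← submatrix_one_equiv spinOneIndexEquiv] at this
    exact (Matrix.reindex spinOneIndexEquiv.symm spinOneIndexEquiv.symm).injective this
  refine ⟨fun _ => 1, (vecMulVec ψ (star ψ)).submatrix spinOneIndexEquiv spinOneIndexEquiv,
    fun a => (F a).submatrix spinOneIndexEquiv spinOneIndexEquiv,
    ⟨(posSemidef_vecMulVec_self_star ψ).submatrix _, by rw [htrace, hρ]⟩,
    ⟨fun a => ?_, ?_⟩, fun a θ => ?_⟩
  · rcases Int.units_eq_one_or a with rfl | rfl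
    · simp only [hF1]; exact hE.submatrix _
    · simp only [hF2]; exact hE'.submatrix _
  · have : ∑ a, F a = 1 := by rw [Int.sum_units, hF1, hF2, add_sub_cancel]
    rw [← submatrix_one_equiv spinOneIndexEquiv, ← this]
    ext i j
    simp [Matrix.sum_apply]
  · rw [spinRotation_two, conjTranspose_submatrix, submatrix_mul_equiv, submatrix_mul_equiv,
      submatrix_mul_equiv, htrace]
    rcases Int.units_eq_one_or a with rfl | rfl
    · rw [hF1, trace_mul_vecMulVec_mul, h]
    · have hs : P (-1) θ = 1 - P 1 θ := by
        rw [← hsum θ, Int.sum_units, add_sub_cancel_left]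
      rw [hF2, mul_sub, mul_one, trace_sub, trace_mul_vecMulVec_mul, ← h, trace_mul_comm,
        ← mul_assoc, hq, one_mul, hρ, hs]
      push_cast
      rfl
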